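/- Let $(X,d)$ be a finite nonempty metric space and let $R=\min_{x\in X}\max_{y\in X} d(x,y)$ be its enclosing radius. For $t\in\mathbb{R}$ let $\mathrm{Rips}_t(X)$ be the simplicial complex of all nonempty subsets $s\subseteq X$ with $\mathrm{diam}(s)\le t$; the full Vietoris--Rips filtration is the family $(\mathrm{Rips}_t(X))_{t\in\mathbb{R}}$, whose largest complex $\bigcup_t \mathrm{Rips}_t(X)$ consists of all nonempty subsets of $X$. Fix a simplex-wise refinement of this filtration, i.e. a total order on the nonempty subsets of $X$ in which $s$ precedes $t$ whenever $\mathrm{diam}(s)<\mathrm{diam}(t)$ or $s\subsetneq t$ (all other ties being broken arbitrarily). For a subcomplex $K$, take the boundary matrix of $K$ over $\mathbb{Z}/2$, with rows and columns indexed by the simplices of $K$ in the given order, and reduce it by the standard algorithm: process the columns from left to right, and while the current column is nonzero and has the same lowest nonzero row as an earlier reduced column, add that earlier column to it. The persistence pairs of $K$ are the pairs $(s,t)$ such that $s$ is the lowest nonzero row of the reduced column of $t$, with persistence interval $[\mathrm{diam}(s),\mathrm{diam}(t))$, together with the pairs $(s,\infty)$ for those $s\in K$ whose reduced column is zero and which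 are not the lowest nonzero row of any reduced column, with interval $[\mathrm{diam}(s),\infty)$. A persistence pair is nonzero if its interval is nonempty. Then the set of nonzero persistence pairs of $\mathrm{Rips}_R(X)$ (the full Rips filtration truncated at diameter $\le R$) is equal to the set of nonzero persistence pairs of the full Rips filtration. -/

import Mathlib

/-! ### The standard matrix reduction over `ℤ/2`

A column is the finite set of its nonzero rows, so the sum of two columns is their symmetric
difference, and the lowest nonzero row of a column `c` is `c.max`, with `c.max = ⊥` for the zero
column. -/

section Reduction

variable {ι : Type*} [LinearOrder ι]

/-- Adding to a nonzero column another column with the same lowest row makes the lowest row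
strictly decrease; this is why the reduction loop stops. -/
theorem max_symmDiff_lt_of_max_eq {a c : Finset ι} (hc : c.Nonempty) (h : a.max = c.max) :
    (symmDiff a c).max < c.max := by
  obtain ⟨m, hm⟩ := Finset.max_of_nonempty hc
  have hmc : m ∈ c := Finset.mem_of_max hm
  have hma : m ∈ a := Finset.mem_of_max (h.trans hm)
  rw [hm]
  rcases (symmDiff a c).eq_empty_or_nonempty with he | hne
  · rw [he, Finset.max_empty]
    exact WithBot.bot_lt_coe m
  · obtain ⟨x, hx⟩ := Finset.max_of_nonempty hne
    have hxm : x ∈ symmDiff a c := Finset.mem_of_max hx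
    rw [hx]
    refine WithBot.coe_lt_coe.mpr (lt_of_le_of_ne ?_ ?_)
    · rcases Finset.mem_symmDiff.mp hxm with ⟨hxa, -⟩ | ⟨hxc, -⟩
      · exact WithBot.coe_le_coe.mp ((h.trans hm) ▸ Finset.le_max hxa)
      · exact WithBot.coe_le_coe.mp (hm ▸ Finset.le_max hxc)
    · rintro rfl
      rcases Finset.mem_symmDiff.mp hxm with ⟨-, hn⟩ | ⟨-, hn⟩
      · exact hn hmc
      · exact hn hma

open Classical in
/-- The loop reducing one column `c` against the columns `R k`, `k ∈ prev`: as long as `c` is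
nonzero and some `R k` has the same lowest row as `c`, replace `c` by `R k + c`. -/
noncomputable def reduceColumn [WellFoundedLT ι] (prev : Set ι) (R : ι → Finset ι)
    (c : Finset ι) : Finset ι :=
  if h : c.Nonempty ∧ ∃ k ∈ prev, (R k).max = c.max then
    reduceColumn prev R (symmDiff (R h.2.choose) c)
  else c
termination_by (wellFounded_lt (α := WithBot ι)).wrap c.max
decreasing_by exact max_symmDiff_lt_of_max_eq h.1 h.2.choose_spec.2

/-- The reduced columns of the matrix with columns `D j`, `j ∈ cols`: the columns are processed
from left to right, and column `j` is reduced against the already reduced columns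
`k ∈ cols`, `k < j`. -/
noncomputable def reduceMatrix [WellFoundedLT ι] (cols : Set ι) (D : ι → Finset ι) (j : ι) :
    Finset ι :=
  reduceColumn {k | k ∈ cols ∧ k < j}
    (fun k => if k < j then reduceMatrix cols D k else ∅) (D j)
termination_by (wellFounded_lt (α := ι)).wrap j
decreasing_by assumption

end Reduction

/-! ### Simplices, Vietoris–Rips complexes and simplex-wise refinements -/

/-- A simplex on the vertex set `X`: a nonempty finite subset of `X`. (A structure, so that it
carries no order by inclusion and can be given a filtration order.) -/
@[ext]
structure Simplex (X : Type*) where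
  /-- the vertices of the simplex -/
  verts : Finset X
  /-- a simplex has a vertex -/
  nonempty : verts.Nonempty

theorem Simplex.verts_injective (X : Type*) :
    Function.Injective (Simplex.verts : Simplex X → Finset X) :=
  fun _ _ h => Simplex.ext h

noncomputable instance (X : Type*) [Fintype X] : Fintype (Simplex X) :=
  Fintype.ofInjective _ (Simplex.verts_injective X)

/-- The diameter of a simplex: the maximal distance between two of its vertices. -/
noncomputable def Simplex.diam {X : Type*} [MetricSpace X] (s : Simplex X) : ℝ :=
  Metric.diam (s.verts : Set X)

open Classical in
/-- The boundary of a simplex `s` over `ℤ/2`, as the set of its facets, i.e. its faces of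
dimension `dim s - 1` (there are none if `s` is a vertex). -/
noncomputable def Simplex.boundary {X : Type*} [Fintype X] (s : Simplex X) :
    Finset (Simplex X) :=
  {f | f.verts ⊆ s.verts ∧ f.verts.card + 1 = s.verts.card}

/-- The complex `Rips_t(X)` of all nonempty subsets of `X` of diameter at most `t`. -/
def ripsComplex (X : Type*) [Fintype X] [MetricSpace X] (t : ℝ) :
    PreAbstractSimplicialComplex X where
  faces := {s | s.Nonempty ∧ Metric.diam (s : Set X) ≤ t}
  isRelLowerSet_faces := by
    rintro s ⟨hs, hd⟩
    refine ⟨hs, fun u hus hu => ⟨hu, le_trans ?_ hd⟩⟩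
    exact Metric.diam_mono (Finset.coe_subset.mpr hus) s.finite_toSet.isBounded

/-- The largest complex of the full Vietoris–Rips filtration, without any diameter threshold. -/
def fullRipsComplex (X : Type*) [Fintype X] [MetricSpace X] : PreAbstractSimplicialComplex X :=
  ⨆ t : ℝ, ripsComplex X t

/-- The enclosing radius `min_x max_y d(x, y)` of a nonempty finite metric space. -/
noncomputable def enclosingRadius (X : Type*) [Fintype X] [Nonempty X] [MetricSpace X] : ℝ :=
  Finset.univ.inf' Finset.univ_nonempty fun x : X =>
    Finset.univ.sup' Finset.univ_nonempty fun y : X => dist x y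

/-- The total order on the simplices of `X` is a simplex-wise refinement of the Vietoris–Rips
filtration: simplices are ordered by increasing diameter, and each simplex comes after its proper
faces. All remaining ties are broken arbitrarily. -/
structure IsSimplexwiseRefinement (X : Type*) [MetricSpace X] [LinearOrder (Simplex X)] :
    Prop where
  lt_of_diam_lt : ∀ s t : Simplex X, s.diam < t.diam → s < t
  lt_of_ssubset : ∀ s t : Simplex X, s.verts ⊂ t.verts → s < t

/-! ### Persistence pairs -/

section Persistence

variable {X : Type*} [Fintype X] [LinearOrder (Simplex X)]

/-- The columns of the boundary matrix of `K`, after reduction; the matrix has one column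
for every simplex of `K`, in the order of the simplices. -/
noncomputable def reducedBoundary (K : PreAbstractSimplicialComplex X) :
    Simplex X → Finset (Simplex X) :=
  reduceMatrix {s | s.verts ∈ K} Simplex.boundary

/-- The persistence pairs of the filtered complex `K`. A pair `(s, some t)` means that `s` is the
lowest nonzero row of the reduced column of `t`: the class created by the birth simplex `s` is
destroyed by the death simplex `t`. A pair `(s, none)` means that `s` creates a class that is
never destroyed: its reduced column is zero and it is not the lowest row of any column. -/
def persistencePairs (K : PreAbstractSimplicialComplex X) :
    Set (Simplex X × Option (Simplex X)) :=
  {p | ∃ t : Simplex X, t.verts ∈ K ∧ p.2 = some t ∧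
      (reducedBoundary K t).max = (p.1 : WithBot (Simplex X))} ∪
  {p | p.1.verts ∈ K ∧ p.2 = none ∧ reducedBoundary K p.1 = ∅ ∧
      ∀ t : Simplex X, t.verts ∈ K → (reducedBoundary K t).max ≠ (p.1 : WithBot (Simplex X))}

variable [MetricSpace X]

/-- The birth time of a persistence pair: the diameter of its birth simplex. -/
noncomputable def birthTime (p : Simplex X × Option (Simplex X)) : WithTop ℝ :=
  (p.1.diam : WithTop ℝ)

/-- The death time of a persistence pair: the diameter of its death simplex, and infinity if
there is none. -/
noncomputable def deathTime (p : Simplex X × Option (Simplex X)) : WithTop ℝ :=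
  p.2.elim ⊤ fun t => (t.diam : WithTop ℝ)

/-- The persistence pairs of `K` of nonzero persistence, i.e. those whose interval
`[birth, death)` is nonempty. -/
def nonzeroPersistencePairs (K : PreAbstractSimplicialComplex X) :
    Set (Simplex X × Option (Simplex X)) :=
  {p ∈ persistencePairs K | birthTime p < deathTime p}

end Persistence

/-!
The reduction only sees a column together with the columns before it, and the simplices of
diameter at most `R` form an initial segment of the filtration order. So the two complexes have the
same reduced columns on that segment (`reduceMatrix_eq_of_isLowerSet`), and it remains to see that
no pair involving a simplex of diameter greater than `R` has nonzero persistence.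

This holds because `Rips_r(X)` is a cone, with apex a point `x` that realizes the enclosing radius,
for all `r ≥ R`. With `∂` the boundary map, `h` the cone map with apex `x` and `ε` the
augmentation, `∂h + h∂ = id + ε(·)[x]` (`boundaryMap_coneMap_add`), so `∂hz = z` for every
boundary `z`.

* Let `s` be the lowest row of the reduced column `z` of `t`, with `diam s < diam t` and
  `R < diam t`. The chain `z = ∂hz` is the boundary of simplices of diameter at most
  `max (diam s) R`, which come before `t`. Hence `z` is a combination of the earlier columns, but
  reduced columns have distinct lowest rows, so a nonzero reduced column is never such a
  combination (`diam_le_of_max_reducedBoundary_eq`).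
* Let the reduced column of `s` be zero with `diam s > R`. There is a cycle `z` with lowest row
  `s`, and `∂hz = z + ε(z)[x]` has lowest row `s` as well. So `s` is the lowest row of some
  reduced column and is not paired with infinity (`exists_max_reducedBoundary_eq`).

The passage between reduced and original columns is linear algebra: reduction preserves the span of
each initial segment of columns (`span_reduceMatrix_eq`), and the lowest row of a combination of
reduced columns is the lowest row of one of them (`exists_max_eq_of_isLowest_of_mem_span`).
-/

/-! ### The matrix reduction in terms of spans of columns -/

section Reduction

open Finsupp

variable {ι : Type*}

/-- The `ℤ/2`-chain of a column: the formal sum of its nonzero rows. -/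
noncomputable def Finset.chain (c : Finset ι) : ι →₀ ZMod 2 :=
  ∑ i ∈ c, single i 1

theorem Finset.chain_apply [DecidableEq ι] (c : Finset ι) (i : ι) :
    c.chain i = if i ∈ c then 1 else 0 := by
  simp [Finset.chain, Finsupp.finsetSum_apply, Finsupp.single_apply]

theorem Finset.chain_symmDiff [DecidableEq ι] (a c : Finset ι) :
    (symmDiff a c).chain = a.chain + c.chain := by
  ext i
  simp only [Finset.chain_apply, Finsupp.add_apply, Finset.mem_symmDiff]
  by_cases ha : i ∈ a <;> by_cases hc : i ∈ c <;> simp [ha, hc]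
  decide

variable [LinearOrder ι]

/-- `i` is the lowest nonzero row of the chain `v`. -/
def IsLowest (v : ι →₀ ZMod 2) (i : ι) : Prop :=
  v i ≠ 0 ∧ ∀ j, i < j → v j = 0

theorem IsLowest.eq {v : ι →₀ ZMod 2} {i j : ι} (hi : IsLowest v i) (hj : IsLowest v j) :
    i = j := by
  rcases lt_trichotomy i j with h | h | h
  · exact absurd (hi.2 j h) hj.1
  · exact h
  · exact absurd (hj.2 i h) hi.1

theorem isLowest_chain_iff {c : Finset ι} {i : ι} : IsLowest c.chain i ↔ c.max = i := by
  constructor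
  · rintro ⟨h1, h2⟩
    simp only [Finset.chain_apply] at h1 h2
    have hi : i ∈ c := by simpa using h1
    refine le_antisymm (Finset.max_le fun a ha => ?_) (Finset.le_max hi)
    by_contra h
    have := h2 a (not_le.mp fun h' => h (WithBot.coe_le_coe.mpr h'))
    simp [ha] at this
  · intro h
    refine ⟨by simp [Finset.chain_apply, Finset.mem_of_max h], fun j hj => ?_⟩
    rw [Finset.chain_apply, if_neg]
    exact fun hjc => (Finset.le_max_of_eq hjc h).not_gt hj

/-- If the nonzero columns among `R k` have pairwise distinct lowest rows, no cancellation of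
lowest rows happens in a linear combination of them. -/
theorem exists_max_eq_of_isLowest_of_mem_span {R : ι → Finset ι}
    (hR : ∀ j k, k < j → (R j).Nonempty → (R k).max ≠ (R j).max) {T : Set ι}
    {v : ι →₀ ZMod 2} (hv : v ∈ Submodule.span (ZMod 2) ((fun k => (R k).chain) '' T))
    {i : ι} (hi : IsLowest v i) : ∃ k ∈ T, (R k).max = i := by
  classical
  obtain ⟨l, hl, rfl⟩ := (Finsupp.mem_span_image_iff_linearCombination _).mp hv
  have hsum : ∀ m, linearCombination (ZMod 2) (fun k => (R k).chain) l m =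
      ∑ k ∈ l.support, l k * (R k).chain m := by
    intro m
    simp [Finsupp.linearCombination_apply, Finsupp.sum, Finsupp.finsetSum_apply]
  -- a column of the combination with the largest lowest row
  have hne : l.support.Nonempty := by
    by_contra h
    rw [Finset.not_nonempty_iff_eq_empty] at h
    exact hi.1 (by rw [hsum, h, Finset.sum_empty])
  obtain ⟨k₀, hk₀, hmax⟩ := Finset.exists_max_image l.support (fun k => (R k).max) hne
  have hnek : (R k₀).Nonempty := by
    by_contra h
    rw [Finset.not_nonempty_iff_eq_empty] at h
    refine hi.1 ((hsum i).trans (Finset.sum_eq_zero fun k hk => ?_))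
    have h1 := hmax k hk
    rw [h, Finset.max_empty, le_bot_iff, Finset.max_eq_bot] at h1
    simp [h1, Finset.chain]
  obtain ⟨m, hm⟩ := Finset.max_of_nonempty hnek
  have hlow : IsLowest (linearCombination (ZMod 2) (fun k => (R k).chain) l) m := by
    constructor
    · rw [hsum, Finset.sum_eq_single_of_mem k₀ hk₀]
      · simpa [Finset.chain_apply, Finset.mem_of_max hm] using hk₀
      · intro k hk hkk
        rw [Finset.chain_apply, if_neg, mul_zero]
        intro hmk
        have h1 : (R k).max = (R k₀).max :=
          le_antisymm (hmax k hk) (hm ▸ Finset.le_max hmk)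
        rcases lt_or_gt_of_ne hkk with h | h
        · exact hR k₀ k h hnek h1
        · exact hR k k₀ h ⟨m, hmk⟩ h1.symm
    · intro j hj
      rw [hsum]
      refine Finset.sum_eq_zero fun k hk => ?_
      rw [Finset.chain_apply, if_neg, mul_zero]
      intro hjk
      exact ((Finset.le_max hjk).trans ((hmax k hk).trans hm.le)).not_gt
        (WithBot.coe_lt_coe.mpr hj)
  exact ⟨k₀, hl hk₀, hm.trans (by rw [hlow.eq hi])⟩

variable [WellFoundedLT ι]

theorem reduceColumn_spec (prev : Set ι) (R : ι → Finset ι) (c : Finset ι) :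
    (reduceColumn prev R c).chain - c.chain ∈
        Submodule.span (ZMod 2) ((fun k => (R k).chain) '' prev) ∧
      ¬ ((reduceColumn prev R c).Nonempty ∧
        ∃ k ∈ prev, (R k).max = (reduceColumn prev R c).max) := by
  induction c using reduceColumn.induct prev R with
  | case1 c h ih =>
    rw [reduceColumn, dif_pos h]
    refine ⟨?_, ih.2⟩
    have h1 := Submodule.add_mem _ ih.1 (Submodule.subset_span
      (Set.mem_image_of_mem (fun k => (R k).chain) h.2.choose_spec.1))
    rw [Finset.chain_symmDiff] at h1
    convert h1 using 1
    abel
  | case2 c h =>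
    rw [reduceColumn, dif_neg h]
    exact ⟨by simp, h⟩

theorem reduceMatrix_sub_mem_span (D : ι → Finset ι) (j : ι) :
    (reduceMatrix Set.univ D j).chain - (D j).chain ∈
      Submodule.span (ZMod 2) ((fun k => (reduceMatrix Set.univ D k).chain) '' Set.Iio j) := by
  have h := (reduceColumn_spec {k | k ∈ Set.univ ∧ k < j}
    (fun k => if k < j then reduceMatrix Set.univ D k else ∅) (D j)).1
  rw [← reduceMatrix] at h
  convert h using 2
  ext v
  simp only [Set.mem_image, Set.mem_Iio, Set.mem_ofPred_eq, Set.mem_univ, true_and]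
  exact exists_congr fun k => and_congr_right fun hk => by rw [if_pos hk]

theorem reduceMatrix_max_ne (D : ι → Finset ι) (j k : ι) (hkj : k < j)
    (hj : (reduceMatrix Set.univ D j).Nonempty) :
    (reduceMatrix Set.univ D k).max ≠ (reduceMatrix Set.univ D j).max := by
  intro hk
  have h := (reduceColumn_spec {k | k ∈ Set.univ ∧ k < j}
    (fun k => if k < j then reduceMatrix Set.univ D k else ∅) (D j)).2
  rw [← reduceMatrix] at h
  exact h ⟨hj, k, ⟨trivial, hkj⟩, by rw [if_pos hkj, hk]⟩

/-- Reduction is a triangular change of columns, so it preserves the span of every initial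
segment of the columns. -/
theorem span_reduceMatrix_eq (D : ι → Finset ι) {T : Set ι} (hT : IsLowerSet T) :
    Submodule.span (ZMod 2) ((fun k => (reduceMatrix Set.univ D k).chain) '' T) =
      Submodule.span (ZMod 2) ((fun k => (D k).chain) '' T) := by
  have hsub : ∀ j ∈ T, Set.Iio j ⊆ T := fun j hj k hk => hT (le_of_lt hk) hj
  apply le_antisymm
  · rw [Submodule.span_le]
    rintro _ ⟨j, hj, rfl⟩
    induction j using WellFoundedLT.induction with
    | ind j ih =>
      have h1 : Submodule.span (ZMod 2)
          ((fun k => (reduceMatrix Set.univ D k).chain) '' Set.Iio j) ≤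
          Submodule.span (ZMod 2) ((fun k => (D k).chain) '' T) := by
        rw [Submodule.span_le]
        rintro _ ⟨k, hk, rfl⟩
        exact ih k hk (hsub j hj hk)
      have h2 := Submodule.add_mem _ (h1 (reduceMatrix_sub_mem_span D j))
        (Submodule.subset_span (Set.mem_image_of_mem (fun k => (D k).chain) hj))
      simpa using h2
  · rw [Submodule.span_le]
    rintro _ ⟨j, hj, rfl⟩
    have h2 := Submodule.sub_mem _ (Submodule.subset_span
        (Set.mem_image_of_mem (fun k => (reduceMatrix Set.univ D k).chain) hj))
      (Submodule.span_mono (Set.image_mono (hsub j hj)) (reduceMatrix_sub_mem_span D j))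
    simpa using h2

/-- The reduction of the columns of an initial segment does not see the later columns. -/
theorem reduceMatrix_eq_of_isLowerSet (D : ι → Finset ι) {T : Set ι} (hT : IsLowerSet T)
    {j : ι} (hj : j ∈ T) : reduceMatrix T D j = reduceMatrix Set.univ D j := by
  induction j using WellFoundedLT.induction with
  | ind j ih =>
    rw [reduceMatrix, reduceMatrix]
    congr 1
    · ext k
      exact ⟨fun h => ⟨trivial, h.2⟩, fun h => ⟨hT h.2.le hj, h.2⟩⟩
    · funext k
      split_ifs with hk
      · exact ih k hk (hT hk.le hj)
      · rfl

/-- A reduced column which is a linear combination of earlier columns is zero. -/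
theorem reduceMatrix_eq_empty_of_mem_span (D : ι → Finset ι) {j : ι}
    (hj : (reduceMatrix Set.univ D j).chain ∈
      Submodule.span (ZMod 2) ((fun k => (D k).chain) '' Set.Iio j)) :
    reduceMatrix Set.univ D j = ∅ := by
  rw [← span_reduceMatrix_eq D (isLowerSet_Iio j)] at hj
  by_contra h
  have hne := Finset.nonempty_iff_ne_empty.mpr h
  obtain ⟨m, hm⟩ := Finset.max_of_nonempty hne
  obtain ⟨k, hk, hkm⟩ := exists_max_eq_of_isLowest_of_mem_span (reduceMatrix_max_ne D) hj
    (isLowest_chain_iff.mpr hm)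
  exact reduceMatrix_max_ne D j k hk hne (hkm.trans hm.symm)

end Reduction

/-! ### The cone homotopy -/

section Homotopy

open Finsupp

variable {X : Type*}

/-- The chain with the single simplex `u`; the empty set contributes zero, so that the chain
complex is not augmented. -/
noncomputable def simplexChain (u : Finset X) : Simplex X →₀ ZMod 2 :=
  if h : u.Nonempty then single ⟨u, h⟩ 1 else 0

theorem simplexChain_verts (s : Simplex X) : simplexChain s.verts = single s 1 := by
  simp [simplexChain, s.nonempty]

theorem simplexChain_empty : simplexChain (∅ : Finset X) = 0 := by
  simp [simplexChain]

/-- The boundary operator on chains. -/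
noncomputable def boundaryMap (X : Type*) [Fintype X] :
    (Simplex X →₀ ZMod 2) →ₗ[ZMod 2] (Simplex X →₀ ZMod 2) :=
  linearCombination (ZMod 2) fun s => s.boundary.chain

theorem boundaryMap_single [Fintype X] (s : Simplex X) :
    boundaryMap X (single s 1) = s.boundary.chain := by
  simp [boundaryMap]

theorem span_chain_boundary_eq_map [Fintype X] (T : Set (Simplex X)) :
    Submodule.span (ZMod 2) ((fun s : Simplex X => s.boundary.chain) '' T) =
      (Finsupp.supported (ZMod 2) (ZMod 2) T).map (boundaryMap X) :=
  Finsupp.span_image_eq_map_linearCombination _ _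

/-- The augmentation, counting the vertices of a chain modulo `2`. -/
noncomputable def augmentation (X : Type*) : (Simplex X →₀ ZMod 2) →ₗ[ZMod 2] ZMod 2 :=
  linearCombination (ZMod 2) fun s => if s.verts.card = 1 then 1 else 0

variable [DecidableEq X]

/-- The cone operator with apex `x`: it adds the vertex `x` to the simplices not containing it,
and kills those containing it. -/
noncomputable def coneMap (x : X) :
    (Simplex X →₀ ZMod 2) →ₗ[ZMod 2] (Simplex X →₀ ZMod 2) :=
  linearCombination (ZMod 2) fun s =>
    if x ∈ s.verts then 0 else simplexChain (insert x s.verts)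

theorem coneMap_single (x : X) (s : Simplex X) : coneMap x (single s 1) =
    if x ∈ s.verts then 0 else simplexChain (insert x s.verts) := by
  simp [coneMap]

theorem coneMap_simplexChain (x : X) (u : Finset X) : coneMap x (simplexChain u) =
    if x ∈ u ∨ u = ∅ then 0 else simplexChain (insert x u) := by
  rcases u.eq_empty_or_nonempty with rfl | hu
  · simp [simplexChain_empty]
  · have h := coneMap_single x ⟨u, hu⟩
    rw [← simplexChain_verts] at h
    simpa [hu.ne_empty] using h

theorem augmentation_coneMap (x : X) (v : Simplex X →₀ ZMod 2) :
    augmentation X (coneMap x v) = 0 := by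
  suffices h : augmentation X ∘ₗ coneMap x = 0 from LinearMap.congr_fun h v
  refine Finsupp.lhom_ext' fun s => LinearMap.ext_ring ?_
  simp only [LinearMap.comp_apply, lsingle_apply, coneMap_single, LinearMap.zero_apply]
  split_ifs with hx
  · simp
  · have hpos := Finset.card_pos.mpr s.nonempty
    simp [simplexChain, augmentation, Finset.card_insert_of_notMem hx, hpos.ne']

variable [Fintype X]

theorem chain_boundary (s : Simplex X) :
    s.boundary.chain = ∑ a ∈ s.verts, simplexChain (s.verts.erase a) := by
  classical
  ext f
  have hterm : ∀ a, simplexChain (s.verts.erase a) f =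
      if s.verts.erase a = f.verts then 1 else 0 := by
    intro a
    unfold simplexChain
    split_ifs with h1 h2 h2
    · simp [h2]
    · simp [Simplex.ext_iff, h2]
    · exact absurd (h2 ▸ f.nonempty) h1
    · rfl
  rw [Finset.chain_apply, Finsupp.finsetSum_apply, Finset.sum_congr rfl fun a _ => hterm a]
  by_cases hf : f.verts ⊆ s.verts ∧ f.verts.card + 1 = s.verts.card
  · rw [if_pos (by simpa [Simplex.boundary] using hf)]
    obtain ⟨a, ha, hs⟩ := Finset.exists_eq_insert_iff.mpr hf
    rw [Finset.sum_eq_single_of_mem a (hs ▸ Finset.mem_insert_self a _)]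
    · rw [if_pos (by rw [← hs, Finset.erase_insert ha])]
    · intro b hb hba
      rw [if_neg]
      intro h
      rw [← h] at ha
      exact ha (Finset.mem_erase.mpr ⟨hba.symm, hs ▸ Finset.mem_insert_self a _⟩)
  · rw [if_neg (by simpa [Simplex.boundary] using hf), Finset.sum_eq_zero]
    intro a ha
    rw [if_neg]
    intro h
    exact hf (h ▸ ⟨Finset.erase_subset _ _, Finset.card_erase_add_one ha⟩)

theorem boundaryMap_simplexChain (u : Finset X) :
    boundaryMap X (simplexChain u) = ∑ a ∈ u, simplexChain (u.erase a) := by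
  rcases u.eq_empty_or_nonempty with rfl | hu
  · simp [simplexChain_empty]
  · have h := boundaryMap_single ⟨u, hu⟩
    rwa [← simplexChain_verts, chain_boundary] at h

/-- The cone operator is a chain homotopy from the identity to the projection onto the apex. -/
theorem boundaryMap_coneMap_add (x : X) (v : Simplex X →₀ ZMod 2) :
    boundaryMap X (coneMap x v) + coneMap x (boundaryMap X v) =
      v + augmentation X v • simplexChain {x} := by
  suffices h : boundaryMap X ∘ₗ coneMap x + coneMap x ∘ₗ boundaryMap X =
      LinearMap.id + (augmentation X).smulRight (simplexChain {x}) from LinearMap.congr_fun h v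
  refine Finsupp.lhom_ext' fun s => LinearMap.ext_ring ?_
  have haug : augmentation X (single s 1) = if s.verts.card = 1 then 1 else 0 := by
    simp [augmentation]
  simp only [LinearMap.comp_apply, lsingle_apply, LinearMap.add_apply, LinearMap.id_apply,
    LinearMap.smulRight_apply, haug, coneMap_single, boundaryMap_single, chain_boundary,
    map_sum, coneMap_simplexChain]
  rw [← simplexChain_verts]
  generalize s.verts = u
  by_cases hx : x ∈ u
  · rw [if_pos hx, map_zero, zero_add, Finset.sum_eq_single_of_mem x hx]
    · by_cases hu : u.erase x = ∅
      · have hux : u = {x} := by rw [← Finset.insert_erase hx, hu]; rfl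
        subst hux
        simp [← two_smul (ZMod 2), show (2 : ZMod 2) = 0 from rfl]
      · have hcard : u.card ≠ 1 := by
          intro h
          have h1 := Finset.card_erase_add_one hx
          exact hu (Finset.card_eq_zero.mp (by omega))
        simp [hu, hcard, Finset.insert_erase hx]
    · intro a _ hax
      rw [if_pos (Or.inl (Finset.mem_erase.mpr ⟨hax.symm, hx⟩))]
  · rw [if_neg hx, boundaryMap_simplexChain, Finset.sum_insert hx, Finset.erase_insert hx,
      add_assoc, ← Finset.sum_add_distrib]
    congr 1
    -- the two sums cancel, except in the case of a vertex, which has no boundary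
    have hterm : ∀ a ∈ u, simplexChain ((insert x u).erase a) +
        (if x ∈ u.erase a ∨ u.erase a = ∅ then 0 else simplexChain (insert x (u.erase a))) =
        if u.card = 1 then simplexChain {x} else 0 := by
      intro a ha
      have hxa : a ≠ x := fun h => hx (h ▸ ha)
      have h1 : u.card = 1 ↔ u.erase a = ∅ := by
        rw [← Finset.card_eq_zero, ← Finset.card_erase_add_one ha]
        omega
      rw [Finset.erase_insert_of_ne hxa.symm]
      by_cases hu : u.erase a = ∅
      · simp [h1, hu]
      · simp [h1, hu, hx, ← two_smul (ZMod 2), show (2 : ZMod 2) = 0 from rfl]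
    rw [Finset.sum_congr rfl hterm]
    by_cases hu : u.card = 1
    · simp [hu]
    · simp [hu]

/-- Every simplex other than a vertex is the cone over one of its facets, so both identities follow
from the homotopy formula by induction on the vertex set. -/
theorem boundaryMap_augmentation_boundaryMap_simplexChain (u : Finset X) :
    boundaryMap X (boundaryMap X (simplexChain u)) = 0 ∧
      augmentation X (boundaryMap X (simplexChain u)) = 0 := by
  induction u using Finset.induction_on with
  | empty => simp [simplexChain_empty]
  | insert x u hx ih =>
    have hv : boundaryMap X (simplexChain {x}) = 0 := by
      simp [boundaryMap_simplexChain, simplexChain_empty]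
    rcases u.eq_empty_or_nonempty with rfl | hu
    · simp [hv]
    · have h1 := boundaryMap_coneMap_add x (simplexChain u)
      rw [coneMap_simplexChain, if_neg (by simp [hx, hu.ne_empty])] at h1
      have hxa : augmentation X (simplexChain {x}) = 1 := by
        simp [simplexChain, augmentation]
      have h2 := boundaryMap_coneMap_add x (boundaryMap X (simplexChain u))
      rw [ih.1, ih.2] at h2
      simp only [map_zero, add_zero, zero_smul] at h2
      constructor
      · have h3 := congrArg (boundaryMap X) h1
        simp only [map_add, map_smul, hv, h2, smul_zero, add_zero] at h3
        exact add_eq_right.mp h3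
      · have h3 := congrArg (augmentation X) h1
        simp only [map_add, map_smul, augmentation_coneMap, hxa, smul_eq_mul, mul_one,
          add_zero, CharTwo.add_self_eq_zero] at h3
        exact h3

theorem boundaryMap_boundaryMap (v : Simplex X →₀ ZMod 2) :
    boundaryMap X (boundaryMap X v) = 0 := by
  suffices h : boundaryMap X ∘ₗ boundaryMap X = 0 from LinearMap.congr_fun h v
  refine Finsupp.lhom_ext' fun s => LinearMap.ext_ring ?_
  have h := (boundaryMap_augmentation_boundaryMap_simplexChain s.verts).1
  rw [simplexChain_verts] at h
  simpa using h

theorem augmentation_boundaryMap (v : Simplex X →₀ ZMod 2) :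
    augmentation X (boundaryMap X v) = 0 := by
  suffices h : augmentation X ∘ₗ boundaryMap X = 0 from LinearMap.congr_fun h v
  refine Finsupp.lhom_ext' fun s => LinearMap.ext_ring ?_
  have h := (boundaryMap_augmentation_boundaryMap_simplexChain s.verts).2
  rw [simplexChain_verts] at h
  simpa using h

/-- A boundary bounds its cone. -/
theorem boundaryMap_coneMap_boundaryMap (x : X) (v : Simplex X →₀ ZMod 2) :
    boundaryMap X (coneMap x (boundaryMap X v)) = boundaryMap X v := by
  simpa [boundaryMap_boundaryMap, augmentation_boundaryMap] using
    boundaryMap_coneMap_add x (boundaryMap X v)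

end Homotopy

/-! ### Rips complexes above the enclosing radius -/

section Rips

open Finsupp

variable {X : Type*} [MetricSpace X]

theorem Simplex.diam_insert_le [DecidableEq X] {x : X} {r : ℝ} (hx : ∀ y, dist x y ≤ r)
    {s : Simplex X} (hs : s.diam ≤ r) :
    Metric.diam ((insert x s.verts : Finset X) : Set X) ≤ r := by
  have h0 : 0 ≤ r := dist_nonneg.trans (hx x)
  refine Metric.diam_le_of_forall_dist_le h0 fun a ha b hb => ?_
  rw [Finset.mem_coe, Finset.mem_insert] at ha hb
  rcases ha with rfl | ha
  · exact hx b
  · rcases hb with rfl | hb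
    · rw [dist_comm]
      exact hx a
    · exact (Metric.dist_le_diam_of_mem s.verts.finite_toSet.isBounded ha hb).trans hs

/-- The Rips complex at a scale `r` is a cone with apex `x` as soon as `x` is at distance at most
`r` from all points. -/
theorem coneMap_mem_supported [DecidableEq X] {x : X} {r : ℝ} (hx : ∀ y, dist x y ≤ r)
    {v : Simplex X →₀ ZMod 2}
    (hv : v ∈ supported (ZMod 2) (ZMod 2) {s : Simplex X | s.diam ≤ r}) :
    coneMap x v ∈ supported (ZMod 2) (ZMod 2) {s : Simplex X | s.diam ≤ r} := by
  suffices h : supported (ZMod 2) (ZMod 2) {s : Simplex X | s.diam ≤ r} ≤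
      (supported (ZMod 2) (ZMod 2) {s : Simplex X | s.diam ≤ r}).comap (coneMap x) from h hv
  conv_lhs => rw [supported_eq_span_single]
  rw [Submodule.span_le]
  rintro _ ⟨s, hs, rfl⟩
  rw [SetLike.mem_coe, Submodule.mem_comap, coneMap_single]
  split_ifs
  · exact Submodule.zero_mem _
  · rw [simplexChain, dif_pos (Finset.insert_nonempty x _)]
    exact single_mem_supported _ _ (Simplex.diam_insert_le hx hs)

theorem Simplex.diam_le_of_le [LinearOrder (Simplex X)] (h : IsSimplexwiseRefinement X)
    {s t : Simplex X} (hst : s ≤ t) : s.diam ≤ t.diam :=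
  le_of_not_gt fun hd => (h.lt_of_diam_lt t s hd).not_ge hst

theorem Simplex.diam_singleton (x : X) :
    (⟨{x}, Finset.singleton_nonempty x⟩ : Simplex X).diam = 0 := by
  simp [Simplex.diam]

theorem exists_forall_dist_le_enclosingRadius (X : Type*) [Fintype X] [Nonempty X]
    [MetricSpace X] : ∃ x : X, ∀ y, dist x y ≤ enclosingRadius X := by
  obtain ⟨x, -, hx⟩ := Finset.exists_mem_eq_inf' (Finset.univ_nonempty (α := X))
    fun x : X => Finset.univ.sup' Finset.univ_nonempty fun y : X => dist x y
  refine ⟨x, fun y => ?_⟩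
  rw [enclosingRadius, hx]
  exact Finset.le_sup' (fun y => dist x y) (Finset.mem_univ y)

variable [Fintype X]

theorem mem_fullRipsComplex (s : Simplex X) : s.verts ∈ fullRipsComplex X :=
  (le_iSup (ripsComplex X) s.diam : ripsComplex X s.diam ≤ fullRipsComplex X)
    ⟨s.nonempty, le_rfl⟩

theorem mem_ripsComplex_iff {s : Simplex X} {r : ℝ} : s.verts ∈ ripsComplex X r ↔ s.diam ≤ r :=
  ⟨fun h => h.2, fun h => ⟨s.nonempty, h⟩⟩

variable [LinearOrder (Simplex X)]

theorem reducedBoundary_fullRipsComplex :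
    reducedBoundary (fullRipsComplex X) = reduceMatrix Set.univ Simplex.boundary := by
  have h : {s : Simplex X | s.verts ∈ fullRipsComplex X} = Set.univ :=
    Set.eq_univ_of_forall mem_fullRipsComplex
  rw [reducedBoundary, h]

theorem reducedBoundary_ripsComplex (h : IsSimplexwiseRefinement X) {r : ℝ} {t : Simplex X}
    (ht : t.diam ≤ r) :
    reducedBoundary (ripsComplex X r) t = reducedBoundary (fullRipsComplex X) t := by
  rw [reducedBoundary_fullRipsComplex]
  refine reduceMatrix_eq_of_isLowerSet _ (fun a b hba ha => ?_) (mem_ripsComplex_iff.mpr ht)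
  exact mem_ripsComplex_iff.mpr
    ((Simplex.diam_le_of_le h hba).trans (mem_ripsComplex_iff.mp ha))

/-- The reduced column of `t` is a boundary, and it bounds its cone with apex `x`. If `t` paired
with a simplex of smaller diameter, that cone would consist of simplices before `t`, so the reduced
column would be a combination of earlier columns. -/
theorem diam_le_of_max_reducedBoundary_eq (h : IsSimplexwiseRefinement X) {x : X} {r : ℝ}
    (hx : ∀ y, dist x y ≤ r) {s t : Simplex X} (ht : r < t.diam)
    (hst : (reducedBoundary (fullRipsComplex X) t).max = s) : t.diam ≤ s.diam := by
  classical
  rw [reducedBoundary_fullRipsComplex] at hst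
  by_contra! hlt
  set z := reduceMatrix Set.univ (Simplex.boundary (X := X)) t with hz
  -- the first scale at which the complex contains the column and is a cone
  set q := max s.diam r with hq
  have hqt : q < t.diam := max_lt hlt ht
  obtain ⟨c, -, hc⟩ : z.chain ∈ (supported (ZMod 2) (ZMod 2) Set.univ).map (boundaryMap X) := by
    rw [← span_chain_boundary_eq_map, ← span_reduceMatrix_eq _ isLowerSet_univ]
    exact Submodule.subset_span (Set.mem_image_of_mem _ (Set.mem_univ t))
  have hsupp : z.chain ∈ supported (ZMod 2) (ZMod 2) {u : Simplex X | u.diam ≤ q} := by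
    rw [mem_supported']
    intro u hu
    rw [Finset.chain_apply, if_neg]
    exact fun huz => hu
      ((Simplex.diam_le_of_le h (Finset.le_max_of_eq huz hst)).trans (le_max_left _ _))
  have hmem : z.chain ∈ Submodule.span (ZMod 2)
      ((fun u : Simplex X => u.boundary.chain) '' Set.Iio t) := by
    rw [span_chain_boundary_eq_map]
    refine ⟨coneMap x z.chain, supported_mono ?_
      (coneMap_mem_supported (fun y => (hx y).trans (le_max_right _ _)) hsupp), ?_⟩
    · exact fun u hu => h.lt_of_diam_lt u t (lt_of_le_of_lt hu hqt)
    · rw [← hc, boundaryMap_coneMap_boundaryMap]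
  rw [hz, reduceMatrix_eq_empty_of_mem_span _ hmem, Finset.max_empty] at hst
  exact WithBot.bot_ne_coe hst

/-- A zero reduced column of `s` yields a cycle with lowest simplex `s`. Up to the apex of the cone,
which has diameter zero, this cycle is the boundary of its cone, so `s` is the lowest row of some
reduced column. -/
theorem exists_max_reducedBoundary_eq (h : IsSimplexwiseRefinement X) (x : X) {s : Simplex X}
    (hs : 0 < s.diam) (hzero : reducedBoundary (fullRipsComplex X) s = ∅) :
    ∃ t, (reducedBoundary (fullRipsComplex X) t).max = s := by
  classical
  rw [reducedBoundary_fullRipsComplex] at hzero ⊢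
  have hmem := reduceMatrix_sub_mem_span (Simplex.boundary (X := X)) s
  rw [hzero, span_reduceMatrix_eq _ (isLowerSet_Iio s), span_chain_boundary_eq_map] at hmem
  obtain ⟨c, hcs, hc⟩ := hmem
  rw [SetLike.mem_coe, mem_supported'] at hcs
  have hcycle : boundaryMap X (single s 1 + c) = 0 := by
    rw [map_add, boundaryMap_single, hc]
    simp [Finset.chain]
  have hhom := boundaryMap_coneMap_add x (single s 1 + c)
  rw [hcycle, map_zero, add_zero] at hhom
  set p : Simplex X := ⟨{x}, Finset.singleton_nonempty x⟩ with hp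
  have hps : p < s := h.lt_of_diam_lt p s (by rwa [Simplex.diam_singleton])
  have happly : ∀ u, p < u → boundaryMap X (coneMap x (single s 1 + c)) u =
      single s 1 u + c u := by
    intro u hu
    have hx : simplexChain {x} = single p 1 := simplexChain_verts p
    rw [hhom, hx]
    simp [Finsupp.single_eq_of_ne hu.ne']
  have hlow : IsLowest (boundaryMap X (coneMap x (single s 1 + c))) s := by
    constructor
    · rw [happly s hps, hcs s (by simp)]
      simp
    · intro u hu
      rw [happly u (hps.trans hu), hcs u (by simpa using hu.le), single_eq_of_ne hu.ne', add_zero]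
  have hspan : boundaryMap X (coneMap x (single s 1 + c)) ∈ Submodule.span (ZMod 2)
      ((fun k => (reduceMatrix Set.univ (Simplex.boundary (X := X)) k).chain) '' Set.univ) := by
    rw [span_reduceMatrix_eq _ isLowerSet_univ, span_chain_boundary_eq_map, supported_univ]
    exact Submodule.mem_map_of_mem Submodule.mem_top
  obtain ⟨t, -, ht⟩ := exists_max_eq_of_isLowest_of_mem_span (reduceMatrix_max_ne _) hspan hlow
  exact ⟨t, ht⟩

end Rips

theorem mainTheorem5 (X : Type*) [Fintype X] [Nonempty X] [MetricSpace X]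
    [LinearOrder (Simplex X)] (h : IsSimplexwiseRefinement X) :
    nonzeroPersistencePairs (ripsComplex X (enclosingRadius X)) =
      nonzeroPersistencePairs (fullRipsComplex X) := by
  obtain ⟨x, hx⟩ := exists_forall_dist_le_enclosingRadius X
  have hR : 0 ≤ enclosingRadius X := dist_nonneg.trans (hx x)
  ext ⟨s, d⟩
  constructor
  · rintro ⟨⟨t, ht, hd, hst⟩ | ⟨hs, hd, hzero, hne⟩, hlt⟩
    · rw [reducedBoundary_ripsComplex h (mem_ripsComplex_iff.mp ht)] at hst
      exact ⟨Or.inl ⟨t, mem_fullRipsComplex t, hd, hst⟩, hlt⟩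
    · have hs' := mem_ripsComplex_iff.mp hs
      rw [reducedBoundary_ripsComplex h hs'] at hzero
      refine ⟨Or.inr ⟨mem_fullRipsComplex s, hd, hzero, fun t _ ht => ?_⟩, hlt⟩
      rcases le_or_gt t.diam (enclosingRadius X) with htR | htR
      · refine hne t (mem_ripsComplex_iff.mpr htR) ?_
        rwa [reducedBoundary_ripsComplex h htR]
      · exact htR.not_ge ((diam_le_of_max_reducedBoundary_eq h hx htR ht).trans hs')
  · rintro ⟨⟨t, -, hd, hst⟩ | ⟨-, hd, hzero, hne⟩, hlt⟩
    · have htR : t.diam ≤ enclosingRadius X := by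
        by_contra! htR
        obtain rfl : d = some t := hd
        exact (WithTop.coe_lt_coe.mp hlt).not_ge (diam_le_of_max_reducedBoundary_eq h hx htR hst)
      refine ⟨Or.inl ⟨t, mem_ripsComplex_iff.mpr htR, hd, ?_⟩, hlt⟩
      rwa [reducedBoundary_ripsComplex h htR]
    · have hs : s.diam ≤ enclosingRadius X := by
        by_contra! hs
        obtain ⟨t, ht⟩ := exists_max_reducedBoundary_eq h x (hR.trans_lt hs) hzero
        exact hne t (mem_fullRipsComplex t) ht
      refine ⟨Or.inr ⟨mem_ripsComplex_iff.mpr hs, hd, ?_, fun t ht => ?_⟩, hlt⟩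
      · exact (reducedBoundary_ripsComplex h hs).trans hzero
      · rw [reducedBoundary_ripsComplex h (mem_ripsComplex_iff.mp ht)]
        exact hne t (mem_fullRipsComplex t)
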